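/- **Theorem.** Fix the following random access machine: it has finitely many registers and arrays of natural numbers; in one step it clears, copies or increments a register, reads or writes one array cell whose address is held in a register, or branches on a comparison ($=$ or $<$) of two registers. For integers $r,d\ge 2$ let $F_r$ be the free group on $x_1,\dots,x_r$ and $S_{r,d}=F_r/F_r^{(d)}$ the free solvable group of rank $r$ and class $d$, where $F_r^{(d)}$ is the $d$-th derived subgroup. For a word $w=x_{i_1}^{\varepsilon_1}\cdots x_{i_n}^{\varepsilon_n}$ ($\varepsilon_j=\pm1$, not necessarily reduced) of length $|w|=n$, let $w_j$ be its prefix of length $j$, $0\le j\le n$; the $S_{r,c}$-partition function of the prefixes of $w$ is the map $P_c:\{0,\dots,n\}\to\{0,\dots,n\}$ for which $P_c(j)$ is the least $i$ with $w_i=w_j$ in $S_{r,c}$. Consider the following algorithm, written as one program for this machine that does not depend on $r,d,w$. Its input is $r$, $d$ and $w$ (stored as $d$, $r$, $|w|$ in registers and the indices and signs of the letters in two arrays). It starts with the partition function $P_0\equiv 0$ of the trivial group $S_{r,0}$. For $c=1,\dots,d$ it computes $P_c$ from $P_{c-1}$: for all $0\le s<t\le n$ with $P_{c-1}(s)=P_{c-1}(t)$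 it takes $w_s=w_t$ to hold in $S_{r,c}$ if and only if, for every $k=1,\dots,r$, after collecting equal terms all coefficients vanish in the formal sum $$-\sum_{s<j\le t,\ i_j=k,\ \varepsilon_j=1} w_{P_{c-1}(j-1)}\;+\sum_{s<j\le t,\ i_j=k,\ \varepsilon_j=-1} w_{P_{c-1}(j)},$$ which represents the difference $\partial w_s/\partial x_k-\partial w_t/\partial x_k$ of Fox derivatives in $\mathbb Z S_{r,c-1}$. It sets $P_c(t)$ to the least such $s$, or to $t$ if there is none. Finally it outputs True if $P_d(0)=P_d(n)$ and False otherwise. This algorithm solves the Word Problem in all groups $S_{r,d}$ uniformly in time $O(d\,r\,|w|^3)$: there is an absolute constant $C$ such that for all $r,d\ge2$ and all words $w$ in $x_1^{\pm1},\dots,x_r^{\pm1}$ the program halts after at most $C\,d\,r\,\max(|w|,1)^3$ steps, with output True if $w=1$ in $S_{r,d}$ and False if $w\ne1$ in $S_{r,d}$. Moreover, for each $c=1,\dots,d$ the partition function that it holds after $c$ refinements is the $S_{r,c}$-partition function of the prefixes of $w$. -/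

import Mathlib

namespace FreeSolvableWP

/-! ### A random access machine

A machine has finitely many registers (named by `V`) and finitely many memories (named by `A`), each
of which is an array of natural numbers. The elementary operations are: clearing, copying and
incrementing a register, reading and writing one array cell whose address is in a register, and one
comparison of two registers that decides on the further control flow. Every elementary operation is
one step. There is no arithmetic but the increment, so after `T` steps no number exceeds the
largest input number plus `T`. -/

/-- The tests: equality and order of the contents of two registers. -/
inductive Test (V : Type) : Type
  | eq (x y : V)
  | lt (x y : V)

/-- The instructions. A program is a list of instructions. -/
inductive Cmd (V A : Type) : Type
  /-- `x := 0` -/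
  | zero (x : V)
  /-- `x := y` -/
  | copy (x y : V)
  /-- `x := x + 1` -/
  | inc (x : V)
  /-- `x := a[i]` -/
  | load (x : V) (a : A) (i : V)
  /-- `a[i] := x` -/
  | store (a : A) (i : V) (x : V)
  /-- `if b then yes else no` -/
  | branch (b : Test V) (yes no : List (Cmd V A))
  /-- `while b do body` -/
  | loop (b : Test V) (body : List (Cmd V A))

/-- The contents of the registers and of the arrays. -/
@[ext] structure Store (V A : Type) : Type where
  reg : V → ℕ
  arr : A → ℕ → ℕ

section Machine

variable {V A : Type} [DecidableEq V] [DecidableEq A]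

/-- The outcome of a test. -/
def Test.holds (σ : Store V A) : Test V → Bool
  | .eq x y => decide (σ.reg x = σ.reg y)
  | .lt x y => decide (σ.reg x < σ.reg y)

/-- Write `v` into the register `x`. -/
def Store.setReg (σ : Store V A) (x : V) (v : ℕ) : Store V A :=
  { σ with reg := Function.update σ.reg x v }

/-- Write `v` into the cell with address `i` of the array `a`. -/
def Store.setArr (σ : Store V A) (a : A) (i v : ℕ) : Store V A :=
  { σ with arr := Function.update σ.arr a (Function.update (σ.arr a) i v) }

/-- A configuration: the instructions that are still to be executed, and the memory. -/
abbrev Config (V A : Type) : Type := List (Cmd V A) × Store V A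

/-- One step of the computation. The machine has halted when no instruction is left. -/
def step : Config V A → Option (Config V A)
  | ([], _) => none
  | (.zero x :: K, σ) => some (K, σ.setReg x 0)
  | (.copy x y :: K, σ) => some (K, σ.setReg x (σ.reg y))
  | (.inc x :: K, σ) => some (K, σ.setReg x (σ.reg x + 1))
  | (.load x a i :: K, σ) => some (K, σ.setReg x (σ.arr a (σ.reg i)))
  | (.store a i x :: K, σ) => some (K, σ.setArr a (σ.reg i) (σ.reg x))
  | (.branch b yes no :: K, σ) => some ((if b.holds σ then yes else no) ++ K, σ)
  | (.loop b body :: K, σ) =>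
      some (if b.holds σ then body ++ .loop b body :: K else K, σ)

/-- `ReachesIn m C C'`: the computation that starts in `C` is in the configuration `C'` after
exactly `m` steps. -/
def ReachesIn (m : ℕ) (C C' : Config V A) : Prop :=
  (fun o : Option (Config V A) => o.bind step)^[m] (some C) = some C'

end Machine

/-- `for i = lo, …, hi - 1 do body` -/
def forLoop {V A : Type} (i lo hi : V) (body : List (Cmd V A)) : List (Cmd V A) :=
  [.copy i lo, .loop (.lt i hi) (body ++ [.inc i])]

/-! ### The algorithm -/

/-- The registers. `rank`, `cls`, `len` hold the input numbers `r`, `d`, `|w|`; `nul`, `one`, `size`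
hold the constants `0`, `1`, `|w| + 1`; `out` receives the answer. -/
inductive Var : Type
  | rank | cls | len | nul | one | size | c | s | t | k | i | j | x | y | p | q | flag | out
  deriving DecidableEq

/-- The arrays. `letter` and `sign` hold the input word, `part` the current partition function,
`next` the partition function under construction, and `plus`, `minus` the numbers of positive and
of negative occurrences of the terms of a sum in the group ring. -/
inductive Arr : Type
  | letter | sign | part | next | plus | minus
  deriving DecidableEq

/-- Sets the constants, and the partition function of `D_w` for the trivial group `S_{r,0}`, which
is constantly `0`. -/
def setUp : List (Cmd Var Arr) :=
  [.zero .nul, .zero .one, .inc .one, .copy .size .len, .inc .size] ++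
  forLoop .i .nul .size [.store .part .i .nul]

/-- Given the indices `s < t` of two prefixes and the partition function `P = part` of the set of all
prefixes `w_0, …, w_n` for a group `G`, decides whether
`∂w_s/∂x_k = ∂w_t/∂x_k` in `ℤG` for all `k`, by collecting similar terms in
`∂w_s/∂x_k - ∂w_t/∂x_k = - ∑ w_{P(j-1)} + ∑ w_{P(j)}`,
where `j` ranges over `s + 1, …, t`, in the first sum over the positions with letter `x_k`, in the
second over those with letter `x_k⁻¹`. Positions of letters are counted from `0` in the code.
The answer is left in `flag`. -/
def compareDerivatives : List (Cmd Var Arr) :=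
  [.zero .flag, .inc .flag] ++
  forLoop .k .nul .rank (
    forLoop .i .nul .size [.store .plus .i .nul, .store .minus .i .nul] ++
    forLoop .j .s .t [
      .load .x .letter .j,
      .branch (.eq .x .k) [
        .load .y .sign .j,
        .branch (.eq .y .one)
          [.load .p .part .j,
           .load .q .minus .p, .inc .q, .store .minus .p .q]
          [.copy .i .j, .inc .i, .load .p .part .i,
           .load .q .plus .p, .inc .q, .store .plus .p .q]] []] ++
    forLoop .i .nul .size [
      .load .x .plus .i, .load .y .minus .i,
      .branch (.eq .x .y) [] [.zero .flag]])

/-- Passes from the partition function `part` for `S_{r,c-1}` to the one for `S_{r,c}`, by comparing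
all pairs of prefixes `w_s`, `w_t`, `s < t`, that are equal in `S_{r,c-1}`. -/
def refinePartition : List (Cmd Var Arr) :=
  forLoop .t .nul .size (
    [.store .next .t .t] ++
    forLoop .s .nul .t [
      .load .x .part .s, .load .y .part .t,
      .branch (.eq .x .y)
        (compareDerivatives ++
          [.branch (.eq .flag .one)
            [.load .x .next .t, .branch (.eq .x .t) [.store .next .t .s] []] []]) []]) ++
  forLoop .i .nul .size [.load .x .next .i, .store .part .i .x]

/-- The main loop: as long as the number `c` of refinements made so far is less than `d`, refine the
partition once more. -/
def mainLoop : Cmd Var Arr :=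
  .loop (.lt .c .cls) (refinePartition ++ [.inc .c])

/-- The answer: `1` (true) if `P(0) = P(n)`, and `0` (false) otherwise. -/
def answer : List (Cmd Var Arr) :=
  [.load .x .part .nul, .load .y .part .len,
   .branch (.eq .x .y) [.copy .out .one] [.copy .out .nul]]

/-- The whole program; it is the same for all `r`, `d` and `w`. -/
def wpSolvable : List (Cmd Var Arr) :=
  setUp ++ [.copy .c .nul] ++ mainLoop :: answer

/-- The initial memory on input `r`, `d`, `w`: the letter `x_k^{±1}` at position `j` of `w` is given
by `letter[j] = k` (the generators being `x_0, …, x_{r-1}`) and `sign[j] = 1` for `x_k`,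
`sign[j] = 0` for `x_k⁻¹`. All other cells and registers hold `0`. -/
def input (r d : ℕ) (w : List (Fin r × Bool)) : Store Var Arr where
  reg
    | .rank => r
    | .cls => d
    | .len => w.length
    | _ => 0
  arr
    | .letter => fun j => (w[j]?.map fun l => (l.1 : ℕ)).getD 0
    | .sign => fun j => (w[j]?.map fun l => l.2.toNat).getD 0
    | _ => fun _ => 0

/-! ### Free solvable groups -/

/-- The free solvable group `S_{r,d} = F_r / F_r^{(d)}` of rank `r` and class `d`. -/
abbrev FreeSolvableGroup (r d : ℕ) : Type :=
  FreeGroup (Fin r) ⧸ derivedSeries (FreeGroup (Fin r)) d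

/-- The element of `S_{r,d}` represented by a word in the letters `x_k^{±1}`; `(k, true)` stands for
`x_k` and `(k, false)` for `x_k⁻¹`. -/
def wordElt (r d : ℕ) (w : List (Fin r × Bool)) : FreeSolvableGroup r d :=
  QuotientGroup.mk (FreeGroup.mk w)

/-- `P` is the `S_{r,c}`-partition function of the prefixes `w_0, …, w_n` of the word `w` of length
`n`: for each `j ≤ n`, `P j` is the least `i` with `w_i = w_j` in `S_{r,c}`. -/
def IsPartitionFunction (r c : ℕ) (w : List (Fin r × Bool)) (P : ℕ → ℕ) : Prop :=
  ∀ j ≤ w.length,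
    IsLeast {i | i ≤ w.length ∧ wordElt r c (w.take i) = wordElt r c (w.take j)} (P j)

end FreeSolvableWP

namespace FreeSolvableWP

open Finset

/-! ### The Magnus embedding, in the language of flows on Cayley graphs -/

/-! ### Zero flow implies membership in the commutator subgroup. -/

section Flow

variable {F : Type*} [Group F] (N : Subgroup F) [N.Normal]

/-! Let `N` be the `c`-th derived subgroup of the free group `F`, so that `⁅N, N⁆` is the next one.
A word traces a path in the Cayley graph of `F ⧸ N`, and the coefficient of `g` in the change of its
`k`-th Fox derivative is the net flow of the path through the edge `(k, g)`. The refinement step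
rests on one equivalence: if `u s` and `u t` agree modulo `N`, then `(u s)⁻¹ * u t ∈ ⁅N, N⁆` if and
only if the net flow between them vanishes on every edge.

If the flow vanishes, choose coset representatives and send each edge to the class of its Schreier
element in the abelianization of `N`. The image of a path telescopes to the difference of the
defects of its ends, so zero flow makes these defects equal modulo `⁅N, N⁆`
(`mem_commutator_of_flow_eq_zero`). Conversely, the Magnus homomorphism into a wreath product with
base values in `ℤ` sends `N` into the abelian base group, hence kills `⁅N, N⁆`. Its base coordinate
is the Fox derivative, whose increments along the path are the flow
(`flow_eq_zero_of_mem_commutator`).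

All vertices on the path are prefixes, so a partition function names them by numbers up to `n`, and
the flow can be computed by counting in two arrays (`balanced_iff`, `merged_iff`). One comparison
costs `O(r n)` steps, there are `O(n²)` pairs and `d` refinements. Programs are verified by loop
invariants that carry step bounds; lists of the cells a program may change transport everything
else. -/

/-- The deviation of `f` from the chosen representative of its coset. -/
noncomputable def cosetDefect (f : F) : N :=
  ⟨f * (Quotient.out (f : F ⧸ N))⁻¹, by
    have h : ((Quotient.out (f : F ⧸ N) : F) : F ⧸ N) = f := Quotient.out_eq _
    have := (QuotientGroup.eq (s := N)).1 h
    exact (Subgroup.Normal.mem_comm_iff inferInstance).1 this⟩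

/-- Replacing `f` by its representative does not change the coset of `f * x`. The second factor is a
Schreier element and depends only on the edge of the quotient graph, not on `f`. -/
theorem cosetDefect_mul (f x : F) :
    cosetDefect N (f * x) =
      cosetDefect N f * cosetDefect N (Quotient.out (f : F ⧸ N) * x) := by
  have h : ((Quotient.out (f : F ⧸ N) : F) : F ⧸ N) = f := Quotient.out_eq _
  ext
  simp only [cosetDefect, Subgroup.coe_mul, QuotientGroup.mk_mul, h]
  group

/-- The homomorphism from the group of `1`-chains on the Cayley graph of `F ⧸ N` to the
abelianization of `N` that is given by a choice of coset representatives. -/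
noncomputable def chainToAbelianization {K : Type*} (x : K → F) :
    (K × (F ⧸ N) →₀ ℤ) →+ Additive (Abelianization N) :=
  Finsupp.liftAddHom fun p => zmultiplesHom _
    (Additive.ofMul (Abelianization.of (cosetDefect N (Quotient.out p.2 * x p.1))))

/-- Written additively, the cocycle identity turns the value of an edge into a difference of
potentials at its ends, so sums along paths telescope. -/
theorem chainToAbelianization_single {K : Type*} (x : K → F) (k : K) (f : F) :
    chainToAbelianization N x (Finsupp.single (k, (f : F ⧸ N)) 1) =
      Additive.ofMul (Abelianization.of (cosetDefect N (f * x k))) -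
        Additive.ofMul (Abelianization.of (cosetDefect N f)) := by
  rw [cosetDefect_mul N f, map_mul, ofMul_mul, add_sub_cancel_left]
  simp [chainToAbelianization]

/-- The path `u s, …, u t` in the Cayley graph of `F` traverses the edges with labels `x (l j)`,
forwards if `ε j` and backwards otherwise. -/
def IsPath {K : Type*} (x : K → F) (u : ℕ → F) (l : ℕ → K) (ε : ℕ → Prop) (s t : ℕ) : Prop :=
  ∀ j ∈ Ico s t, (ε j → u (j + 1) = u j * x (l j)) ∧ (¬ ε j → u j = u (j + 1) * x (l j))

open Classical in
/-- The flow through the edge `(k, g)` of the Cayley graph of `F ⧸ N` at the step `j`. -/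
noncomputable def flowAt {K : Type*} (u : ℕ → F) (l : ℕ → K) (ε : ℕ → Prop) (k : K) (g : F ⧸ N)
    (j : ℕ) : ℤ :=
  (if l j = k ∧ ε j ∧ (u j : F ⧸ N) = g then 1 else 0) -
    if l j = k ∧ ¬ ε j ∧ (u (j + 1) : F ⧸ N) = g then 1 else 0

theorem mem_commutator_of_flow_eq_zero {K : Type*} {x : K → F} {u : ℕ → F} {l : ℕ → K}
    {ε : ℕ → Prop} {s t : ℕ} (hst : s ≤ t) (hu : IsPath x u l ε s t)
    (hN : (u s : F ⧸ N) = u t) (h0 : ∀ k g, ∑ j ∈ Ico s t, flowAt N u l ε k g j = 0) :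
    (u s)⁻¹ * u t ∈ ⁅N, N⁆ := by
  classical
  -- The path as a 1-chain: its coefficient at `(k, g)` is the total flow there, which vanishes by
  -- hypothesis.
  have hchain : ∑ j ∈ Ico s t, (if ε j then Finsupp.single (l j, (u j : F ⧸ N)) (1 : ℤ)
      else -Finsupp.single (l j, (u (j + 1) : F ⧸ N)) 1) = 0 := by
    ext ⟨k, g⟩
    rw [Finsupp.finsetSum_apply, Finsupp.zero_apply, ← h0 k g]
    refine sum_congr rfl fun j _ => ?_
    by_cases hε : ε j <;> simp [flowAt, hε, Finsupp.single_apply]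
  have htel := congrArg (chainToAbelianization N x) hchain
  rw [map_sum, map_zero, sum_congr rfl (g := fun j =>
    Additive.ofMul (Abelianization.of (cosetDefect N (u (j + 1)))) -
      Additive.ofMul (Abelianization.of (cosetDefect N (u j)))),
    sum_Ico_sub (fun j => Additive.ofMul (Abelianization.of (cosetDefect N (u j)))) hst,
    sub_eq_zero] at htel
  · have h1 : (cosetDefect N (u s))⁻¹ * cosetDefect N (u t) ∈ commutator N := by
      rw [← Abelianization.ker_of, MonoidHom.mem_ker, map_mul, map_inv,
        Additive.ofMul.injective htel, inv_mul_cancel]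
    have h2 := Subgroup.mem_map_of_mem N.subtype h1
    rw [Subgroup.map_subtype_commutator] at h2
    -- By `hN` both defects use the same representative `o`, so `h2` concerns `o * (u s)⁻¹ * u t *
    -- o⁻¹`; normality removes the conjugation.
    have h3 := (Subgroup.commutator_normal N N).conj_mem _ h2 (Quotient.out (u s : F ⧸ N))⁻¹
    convert h3 using 1
    simp only [cosetDefect, Subgroup.subtype_apply, Subgroup.coe_mul, Subgroup.coe_inv, hN]
    group
  · intro j hj
    by_cases hε : ε j
    · rw [if_pos hε, chainToAbelianization_single, ← (hu j hj).1 hε]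
    · rw [if_neg hε, map_neg, chainToAbelianization_single, ← (hu j hj).2 hε, neg_sub]

end Flow

/-! ### Membership in the commutator subgroup implies zero flow. -/

section Magnus

variable {α : Type*} (N : Subgroup (FreeGroup α)) [N.Normal]

open Classical in
/-- The Magnus homomorphism, whose first component is the Fox derivative with respect to the
generator `k`. -/
noncomputable def magnusHom (k : α) :
    FreeGroup α →* RegularWreathProduct (Multiplicative ℤ) (FreeGroup α ⧸ N) :=
  FreeGroup.lift fun i =>
    ⟨fun g => if i = k ∧ 1 = g then Multiplicative.ofAdd 1 else 1, (FreeGroup.of i : FreeGroup α)⟩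

theorem magnusHom_right (k : α) (f : FreeGroup α) : (magnusHom N k f).right = f := by
  have : (RegularWreathProduct.rightHom).comp (magnusHom N k) = QuotientGroup.mk' N := by
    ext i
    simp [magnusHom, RegularWreathProduct.rightHom]
  exact DFunLike.congr_fun this f

/-- Elements of `N` have trivial right component, so they land in the base group of functions to
`ℤ`, which is commutative. -/
theorem magnusHom_eq_one {k : α} {f : FreeGroup α} (hf : f ∈ ⁅N, N⁆) : magnusHom N k f = 1 := by
  have : ⁅N, N⁆ ≤ (magnusHom N k).ker := by
    rw [Subgroup.commutator_le]
    intro a ha b hb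
    have ha' := magnusHom_right N k a
    have hb' := magnusHom_right N k b
    rw [(QuotientGroup.eq_one_iff a).2 ha] at ha'
    rw [(QuotientGroup.eq_one_iff b).2 hb] at hb'
    rw [MonoidHom.mem_ker, map_commutatorElement, commutatorElement_eq_one_iff_mul_comm]
    ext g
    · simp [RegularWreathProduct.mul_def, ha', hb', mul_comm]
    · simp [RegularWreathProduct.mul_def, ha', hb']
  exact this hf

-- This is the Fox product rule for `f * x_i`: multiplying by a generator adds the single term `f`
-- when `i = k`.
open Classical in
theorem magnusHom_mul_of_left (k i : α) (f : FreeGroup α) (g : FreeGroup α ⧸ N) :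
    ((magnusHom N k (f * FreeGroup.of i)).left g).toAdd =
      ((magnusHom N k f).left g).toAdd + if i = k ∧ (f : FreeGroup α ⧸ N) = g then 1 else 0 := by
  rw [map_mul, RegularWreathProduct.mul_def]
  simp only [magnusHom_right, Pi.mul_apply, toAdd_mul]
  congr 1
  simp only [magnusHom, FreeGroup.lift_apply_of, eq_comm (a := (1 : FreeGroup α ⧸ N)),
    inv_mul_eq_one]
  split_ifs <;> rfl

/-- Each flow term is the increment of the coefficient of `g` in a Fox derivative, so the sum
telescopes to a difference that `magnusHom_eq_one` makes zero. The hypothesis `hk` allows labels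
from a type other than that of the generators; the program uses natural numbers. -/
theorem flow_eq_zero_of_mem_commutator {K : Type*} {x : K → FreeGroup α} {u : ℕ → FreeGroup α}
    {l : ℕ → K} {ε : ℕ → Prop} {s t : ℕ} (hst : s ≤ t) (hu : IsPath x u l ε s t) {k : K}
    {i : α} (hk : ∀ j ∈ Ico s t, ∃ i', x (l j) = FreeGroup.of i' ∧ (i' = i ↔ l j = k))
    (h : (u s)⁻¹ * u t ∈ ⁅N, N⁆) (g : FreeGroup α ⧸ N) :
    ∑ j ∈ Ico s t, flowAt N u l ε k g j = 0 := by
  classical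
  have hst' : magnusHom N i (u s) = magnusHom N i (u t) := by
    rw [← inv_mul_eq_one, ← map_inv, ← map_mul, magnusHom_eq_one N h]
  rw [sum_congr rfl (g := fun j => ((magnusHom N i (u (j + 1))).left g).toAdd -
    ((magnusHom N i (u j)).left g).toAdd),
    sum_Ico_sub (fun j => ((magnusHom N i (u j)).left g).toAdd) hst, hst', sub_self]
  intro j hj
  obtain ⟨i', hx, hi'⟩ := hk j hj
  by_cases hε : ε j
  · rw [(hu j hj).1 hε, hx, magnusHom_mul_of_left]
    simp [flowAt, hε, hi']
  · rw [(hu j hj).2 hε, hx, magnusHom_mul_of_left]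
    simp [flowAt, hε, hi']

end Magnus

/-! ### Reasoning about programs -/

section Logic

variable {V A : Type} [DecidableEq V] [DecidableEq A]

theorem ReachesIn.refl (C : Config V A) : ReachesIn 0 C C := rfl

theorem ReachesIn.trans {m n : ℕ} {C C' C'' : Config V A} (h : ReachesIn m C C')
    (h' : ReachesIn n C' C'') : ReachesIn (m + n) C C'' := by
  unfold ReachesIn at *
  rw [add_comm, Function.iterate_add_apply, h, h']

theorem ReachesIn.of_step {C C' : Config V A} (h : step C = some C') : ReachesIn 1 C C' := h

/-- The machine is deterministic, and after halting the iteration stays at `none`; so every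
configuration on the run occurs by time `T`. -/
theorem ReachesIn.le_of_halts {m T : ℕ} {C C' : Config V A} {σ : Store V A}
    (h : ReachesIn m C C') (hT : ReachesIn T C ([], σ)) : m ≤ T := by
  by_contra! hlt
  obtain ⟨n, rfl⟩ := Nat.exists_eq_add_of_lt hlt
  unfold ReachesIn at h hT
  rw [show T + n + 1 = n + (1 + T) by ring, Function.iterate_add_apply,
    Function.iterate_add_apply, hT] at h
  have : ∀ n, (fun o : Option (Config V A) => o.bind step)^[n] none = none := fun n =>
    Function.iterate_fixed rfl n
  simp [step, this] at h

/-- Started in the memory `σ`, the program `L` terminates within `B` steps, in a memory that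
satisfies `Q`. -/
def RunsWithin (L : List (Cmd V A)) (σ : Store V A) (B : ℕ) (Q : Store V A → Prop) : Prop :=
  ∃ m ≤ B, ∃ τ, (∀ K, ReachesIn m (L ++ K, σ) (K, τ)) ∧ Q τ

namespace RunsWithin

variable {L L' : List (Cmd V A)} {σ : Store V A} {B B' : ℕ} {Q Q' : Store V A → Prop}

theorem mono (h : RunsWithin L σ B Q) (hB : B ≤ B') (hQ : ∀ τ, Q τ → Q' τ) :
    RunsWithin L σ B' Q' := by
  obtain ⟨m, hm, τ, hr, hτ⟩ := h
  exact ⟨m, hm.trans hB, τ, hr, hQ τ hτ⟩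

theorem nil (h : Q σ) : RunsWithin [] σ B Q :=
  ⟨0, B.zero_le, σ, fun _ => .refl _, h⟩

theorem append (h : RunsWithin L σ B fun τ => RunsWithin L' τ B' Q) :
    RunsWithin (L ++ L') σ (B + B') Q := by
  obtain ⟨m, hm, τ, hr, m', hm', τ', hr', hQ⟩ := h
  refine ⟨m + m', by omega, τ', fun K => ?_, hQ⟩
  rw [List.append_assoc]
  exact (hr _).trans (hr' K)

theorem of_step {M : List (Cmd V A)} {τ : Store V A}
    (hs : ∀ K, step (L ++ K, σ) = some (M ++ K, τ)) (h : RunsWithin M τ B Q) :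
    RunsWithin L σ (B + 1) Q := by
  obtain ⟨m, hm, τ', hr, hQ⟩ := h
  refine ⟨1 + m, by omega, τ', fun K => ?_, hQ⟩
  exact (ReachesIn.of_step (hs K)).trans (hr K)

theorem zero {x : V} (h : RunsWithin L (σ.setReg x 0) B Q) :
    RunsWithin (.zero x :: L) σ (B + 1) Q :=
  of_step (fun _ => rfl) h

theorem copy {x y : V} (h : RunsWithin L (σ.setReg x (σ.reg y)) B Q) :
    RunsWithin (.copy x y :: L) σ (B + 1) Q :=
  of_step (fun _ => rfl) h

theorem inc {x : V} (h : RunsWithin L (σ.setReg x (σ.reg x + 1)) B Q) :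
    RunsWithin (.inc x :: L) σ (B + 1) Q :=
  of_step (fun _ => rfl) h

theorem load {x i : V} {a : A} (h : RunsWithin L (σ.setReg x (σ.arr a (σ.reg i))) B Q) :
    RunsWithin (.load x a i :: L) σ (B + 1) Q :=
  of_step (fun _ => rfl) h

theorem store {x i : V} {a : A} (h : RunsWithin L (σ.setArr a (σ.reg i) (σ.reg x)) B Q) :
    RunsWithin (.store a i x :: L) σ (B + 1) Q :=
  of_step (fun _ => rfl) h

theorem branch_eq {x y : V} {yes no : List (Cmd V A)}
    (hyes : σ.reg x = σ.reg y → RunsWithin yes σ B fun τ => RunsWithin L τ B' Q)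
    (hno : σ.reg x ≠ σ.reg y → RunsWithin no σ B fun τ => RunsWithin L τ B' Q) :
    RunsWithin (.branch (.eq x y) yes no :: L) σ (B + B' + 1) Q := by
  by_cases h : σ.reg x = σ.reg y
  · exact of_step (M := yes ++ L) (fun K => by simp [step, Test.holds, h]) (append (hyes h))
  · exact of_step (M := no ++ L) (fun K => by simp [step, Test.holds, h]) (append (hno h))

/-- A round costs the body, one test and one increment; the initial copy and the final failing test
give the extra `2`. The number of rounds `h - l` is bounded crudely by `h`. -/
theorem forLoop {i lo hi : V} {l h : ℕ} {body : List (Cmd V A)} (I : ℕ → Store V A → Prop)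
    (hlo : σ.reg lo = l) (hlh : l ≤ h) (hinit : I l (σ.setReg i l))
    (hI : ∀ v τ, I v τ → τ.reg i = v ∧ τ.reg hi = h)
    (hbody : ∀ v τ, l ≤ v → v < h → I v τ →
      RunsWithin body τ B fun τ' => I (v + 1) (τ'.setReg i (τ'.reg i + 1))) :
    RunsWithin (forLoop i lo hi body) σ (2 + h * (B + 2)) (I h) := by
  have key : ∀ n v τ, v + n = h → l ≤ v → I v τ →
      RunsWithin [.loop (.lt i hi) (body ++ [.inc i])] τ (n * (B + 2) + 1) (I h) := by
    intro n
    induction n with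
    | zero =>
      intro v τ hv _ hτ
      obtain rfl : v = h := by omega
      have := hI _ _ hτ
      refine of_step (M := []) (fun K => ?_) (nil hτ)
      simp [step, Test.holds, this]
    | succ n ih =>
      intro v τ hv hl hτ
      have := hI _ _ hτ
      have hlt : v < h := by omega
      refine mono (of_step (M := body ++ ([.inc i] ++ [.loop (.lt i hi) (body ++ [.inc i])]))
        (fun K => ?_) (append (mono (hbody v τ hl hlt hτ) le_rfl fun τ' hτ' =>
          inc (ih (v + 1) _ (by omega) (by omega) hτ')))) ?_ fun _ h => h
      · simp [step, Test.holds, this, hlt]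
      · ring_nf
        omega
  refine mono (copy (key (h - l) l _ (by omega) le_rfl (hlo ▸ hinit))) ?_ fun _ h => h
  have := Nat.mul_le_mul_right (B + 2) (Nat.sub_le h l)
  omega

end RunsWithin

end Logic

/-! ### Tracking which cells a program may change. -/

/-- The memories `σ` and `τ` agree outside the registers `R` and the arrays `S`. -/
def Frame {V A : Type} (R : List V) (S : List A) (σ τ : Store V A) : Prop :=
  (∀ x ∉ R, τ.reg x = σ.reg x) ∧ ∀ a ∉ S, τ.arr a = σ.arr a

namespace Frame

variable {V A : Type} {R R' : List V} {S S' : List A} {σ τ τ' : Store V A}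

theorem refl (R : List V) (S : List A) (σ : Store V A) : Frame R S σ σ :=
  ⟨fun _ _ => rfl, fun _ _ => rfl⟩

theorem trans (h : Frame R S σ τ) (h' : Frame R S τ τ') : Frame R S σ τ' :=
  ⟨fun x hx => (h'.1 x hx).trans (h.1 x hx), fun a ha => (h'.2 a ha).trans (h.2 a ha)⟩

theorem mono (h : Frame R S σ τ) (hR : R ⊆ R') (hS : S ⊆ S') : Frame R' S' σ τ :=
  ⟨fun x hx => h.1 x fun h => hx (hR h), fun a ha => h.2 a fun h => ha (hS h)⟩

theorem setReg [DecidableEq V] (h : Frame R S σ τ) {x : V} (hx : x ∈ R) (v : ℕ) :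
    Frame R S σ (τ.setReg x v) :=
  ⟨fun y hy => (Function.update_of_ne (ne_of_mem_of_not_mem hx hy).symm _ _).trans (h.1 y hy), h.2⟩

theorem setArr [DecidableEq A] (h : Frame R S σ τ) {a : A} (ha : a ∈ S) (i v : ℕ) :
    Frame R S σ (τ.setArr a i v) :=
  ⟨h.1, fun b hb => (Function.update_of_ne (ne_of_mem_of_not_mem ha hb).symm _ _).trans (h.2 b hb)⟩

end Frame

namespace Store

variable {V A : Type}

theorem setReg_reg [DecidableEq V] (σ : Store V A) (x y : V) (v : ℕ) :
    (σ.setReg x v).reg y = if y = x then v else σ.reg y := by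
  simp [setReg, Function.update_apply]

theorem setReg_arr [DecidableEq V] (σ : Store V A) (x : V) (v : ℕ) :
    (σ.setReg x v).arr = σ.arr := rfl

theorem setArr_reg [DecidableEq A] (σ : Store V A) (a : A) (i v : ℕ) :
    (σ.setArr a i v).reg = σ.reg := rfl

theorem setArr_arr [DecidableEq A] (σ : Store V A) (a b : A) (i v j : ℕ) :
    (σ.setArr a i v).arr b j = if b = a ∧ j = i then v else σ.arr b j := by
  simp only [setArr, Function.update_apply]
  split_ifs <;> simp_all

end Store

/-! ### The parts of the program -/

/-- Clears the arrays `plus` and `minus`. -/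
def clearCounters : List (Cmd Var Arr) :=
  forLoop .i .nul .size [.store .plus .i .nul, .store .minus .i .nul]

/-- Counts the terms of the difference of two Fox derivatives. -/
def countTerms : List (Cmd Var Arr) :=
  forLoop .j .s .t [
    .load .x .letter .j,
    .branch (.eq .x .k) [
      .load .y .sign .j,
      .branch (.eq .y .one)
        [.load .p .part .j,
         .load .q .minus .p, .inc .q, .store .minus .p .q]
        [.copy .i .j, .inc .i, .load .p .part .i,
         .load .q .plus .p, .inc .q, .store .plus .p .q]] []]

/-- Clears `flag` unless the arrays `plus` and `minus` agree. -/
def compareCounters : List (Cmd Var Arr) :=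
  forLoop .i .nul .size [
    .load .x .plus .i, .load .y .minus .i,
    .branch (.eq .x .y) [] [.zero .flag]]

theorem compareDerivatives_eq :
    compareDerivatives = [.zero .flag, .inc .flag] ++
      forLoop .k .nul .rank (clearCounters ++ countTerms ++ compareCounters) := rfl

/-- The number of negative occurrences of the prefix class `p` in the difference of the derivatives
with respect to the generator `k`. -/
def minusCount (L S P : ℕ → ℕ) (s t k p : ℕ) : ℕ :=
  ∑ j ∈ Ico s t, if L j = k ∧ S j = 1 ∧ P j = p then 1 else 0

/-- The number of positive occurrences of the prefix class `p` in the difference of the derivatives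
with respect to the generator `k`. -/
def plusCount (L S P : ℕ → ℕ) (s t k p : ℕ) : ℕ :=
  ∑ j ∈ Ico s t, if L j = k ∧ S j ≠ 1 ∧ P (j + 1) = p then 1 else 0

/-- All coefficients of the differences of the derivatives vanish. -/
def Balanced (r n : ℕ) (L S P : ℕ → ℕ) (s t : ℕ) : Prop :=
  ∀ k < r, ∀ p ≤ n, plusCount L S P s t k p = minusCount L S P s t k p

/-! ### Collecting terms of a difference of Fox derivatives. -/

section Counters

variable {n s t k : ℕ} {σ : Store Var Arr}

theorem clearCounters_spec (hnul : σ.reg .nul = 0) (hsize : σ.reg .size = n + 1) :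
    RunsWithin clearCounters σ (4 * (n + 1) + 2) fun τ =>
      Frame [.i] [.plus, .minus] σ τ ∧ ∀ p ≤ n, τ.arr .plus p = 0 ∧ τ.arr .minus p = 0 := by
  refine RunsWithin.mono (RunsWithin.forLoop (B := 2) (fun v τ =>
    Frame [.i] [.plus, .minus] σ τ ∧ τ.reg .i = v ∧
      ∀ p < v, τ.arr .plus p = 0 ∧ τ.arr .minus p = 0) hnul (Nat.zero_le (n + 1)) ?_ ?_ ?_)
    (by omega) fun τ hτ => ⟨hτ.1, fun p hp => hτ.2.2 p (by omega)⟩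
  · exact ⟨(Frame.refl _ _ _).setReg (by decide) _, by simp [Store.setReg_reg], by simp⟩
  · rintro v τ ⟨hF, hi, -⟩
    exact ⟨hi, (hF.1 _ (by decide)).trans hsize⟩
  · rintro v τ - hv ⟨hF, hi, h⟩
    refine .store (.store (.nil (B := 0) ⟨((hF.setArr (by decide) _ _).setArr (by decide) _ _).setReg
      (by decide) _, ?_, fun p hp => ?_⟩))
    · simp [Store.setReg_reg, Store.setArr_reg, hi]
    · have h0 : τ.reg .nul = 0 := (hF.1 _ (by decide)).trans hnul
      rcases Nat.lt_succ_iff_lt_or_eq.1 hp with hp | rfl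
      · simp [Store.setReg_arr, Store.setArr_arr, Store.setArr_reg, h0, h p hp]
      · simp [Store.setReg_arr, Store.setArr_arr, Store.setArr_reg, h0, hi]

theorem countTerms_spec (hone : σ.reg .one = 1) (hs : σ.reg .s = s) (ht : σ.reg .t = t)
    (hk : σ.reg .k = k) (hst : s ≤ t)
    (h0 : ∀ p ≤ n, σ.arr .plus p = 0 ∧ σ.arr .minus p = 0) :
    RunsWithin countTerms σ (12 * t + 2) fun τ =>
      Frame [.i, .j, .x, .y, .p, .q] [.plus, .minus] σ τ ∧ ∀ p ≤ n,
        τ.arr .plus p = plusCount (σ.arr .letter) (σ.arr .sign) (σ.arr .part) s t k p ∧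
        τ.arr .minus p = minusCount (σ.arr .letter) (σ.arr .sign) (σ.arr .part) s t k p := by
  refine RunsWithin.mono (RunsWithin.forLoop (B := 10) (fun v τ =>
    Frame [.i, .j, .x, .y, .p, .q] [.plus, .minus] σ τ ∧ τ.reg .j = v ∧ ∀ p ≤ n,
        τ.arr .plus p = plusCount (σ.arr .letter) (σ.arr .sign) (σ.arr .part) s v k p ∧
        τ.arr .minus p = minusCount (σ.arr .letter) (σ.arr .sign) (σ.arr .part) s v k p)
    hs hst ?_ ?_ ?_) (by omega) fun τ hτ => ⟨hτ.1, hτ.2.2⟩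
  · refine ⟨(Frame.refl _ _ _).setReg (by decide) _, by simp [Store.setReg_reg], ?_⟩
    simpa [plusCount, minusCount, Store.setReg_arr] using h0
  · rintro v τ ⟨hF, hj, -⟩
    exact ⟨hj, (hF.1 _ (by decide)).trans ht⟩
  · rintro v τ hv - ⟨hF, hj, h⟩
    have e1 : τ.reg .one = 1 := (hF.1 _ (by decide)).trans hone
    have e2 : τ.reg .k = k := (hF.1 _ (by decide)).trans hk
    have e3 := hF.2 .letter (by decide)
    have e4 := hF.2 .sign (by decide)
    have e5 := hF.2 .part (by decide)
    -- Advancing `v` adds one summand to each count, to be matched with the single counter the body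
    -- may increment.
    have hplus : ∀ p, plusCount (σ.arr .letter) (σ.arr .sign) (σ.arr .part) s (v + 1) k p =
        plusCount (σ.arr .letter) (σ.arr .sign) (σ.arr .part) s v k p + _ :=
      fun p => sum_Ico_succ_top hv _
    have hminus : ∀ p, minusCount (σ.arr .letter) (σ.arr .sign) (σ.arr .part) s (v + 1) k p =
        minusCount (σ.arr .letter) (σ.arr .sign) (σ.arr .part) s v k p + _ :=
      fun p => sum_Ico_succ_top hv _
    refine .load (.branch_eq (B := 8) (B' := 0) (fun hx => ?_) fun hx => ?_)
    · simp only [Store.setReg_reg, hj, e3, e2, reduceCtorEq, if_true, if_false] at hx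
      refine .load (.branch_eq (B := 6) (B' := 0) (fun hy => ?_) fun hy => ?_)
      · simp only [Store.setReg_reg, Store.setReg_arr, hj, e4, e1, reduceCtorEq, if_true,
          if_false] at hy
        refine .load (.load (.inc (.store (.nil (.nil (.nil ⟨?_, ?_, fun p hp => ?_⟩))))))
        · repeat' first | with_reducible exact hF | with_reducible refine Frame.setReg ?_ ?_ _ |
            with_reducible refine Frame.setArr ?_ ?_ _ _ | decide
        · simp [Store.setReg_reg, Store.setArr_reg, hj]
        · simp only [Store.setReg_reg, Store.setReg_arr, Store.setArr_arr, Store.setArr_reg, hj, e3,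
            e4, e5, reduceCtorEq, if_true, if_false, hplus, hminus, hx, hy, true_and, false_and,
            h p hp]
          obtain rfl | hne := eq_or_ne p (σ.arr .part v) <;> simp [*, Ne.symm]
      · simp only [Store.setReg_reg, Store.setReg_arr, hj, e4, e1, reduceCtorEq, if_true,
          if_false] at hy
        refine .copy (.inc (.load (.load (.inc (.store (.nil (.nil (.nil ⟨?_, ?_,
          fun p hp => ?_⟩))))))))
        · repeat' first | with_reducible exact hF | with_reducible refine Frame.setReg ?_ ?_ _ |
            with_reducible refine Frame.setArr ?_ ?_ _ _ | decide
        · simp [Store.setReg_reg, Store.setArr_reg, hj]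
        · simp only [Store.setReg_reg, Store.setReg_arr, Store.setArr_arr, Store.setArr_reg, hj, e3,
            e4, e5, reduceCtorEq, if_true, if_false, hplus, hminus, hx, hy, true_and, false_and,
            h p hp]
          obtain rfl | hne := eq_or_ne p (σ.arr .part (v + 1)) <;> simp [*, Ne.symm]
    · simp only [Store.setReg_reg, hj, e3, e2, reduceCtorEq, if_true, if_false] at hx
      refine .nil (.nil ⟨?_, ?_, fun p hp => ?_⟩)
      · repeat' first | with_reducible exact hF | with_reducible refine Frame.setReg ?_ ?_ _ |
          with_reducible refine Frame.setArr ?_ ?_ _ _ | decide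
      · simp [Store.setReg_reg, hj]
      · simp [Store.setReg_arr, hplus, hminus, hx, h p hp]

/-- The loop never sets `flag`, it only clears it; hence the conjunction with the old value, which
accumulates the verdicts over all generators. -/
theorem compareCounters_spec (hnul : σ.reg .nul = 0) (hsize : σ.reg .size = n + 1) :
    RunsWithin compareCounters σ (6 * (n + 1) + 2) fun τ =>
      Frame [.i, .x, .y, .flag] [] σ τ ∧
        (τ.reg .flag = 1 ↔ σ.reg .flag = 1 ∧ ∀ p ≤ n, σ.arr .plus p = σ.arr .minus p) := by
  refine RunsWithin.mono (RunsWithin.forLoop (B := 4) (fun v τ =>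
    Frame [.i, .x, .y, .flag] [] σ τ ∧ τ.reg .i = v ∧
      (τ.reg .flag = 1 ↔ σ.reg .flag = 1 ∧ ∀ p < v, σ.arr .plus p = σ.arr .minus p))
    hnul (Nat.zero_le (n + 1)) ?_ ?_ ?_)
    (by omega) fun τ hτ => ⟨hτ.1, by simpa [Nat.lt_succ_iff] using hτ.2.2⟩
  · exact ⟨(Frame.refl _ _ _).setReg (by decide) _, by simp [Store.setReg_reg],
      by simp [Store.setReg_reg]⟩
  · rintro v τ ⟨hF, hi, -⟩
    exact ⟨hi, (hF.1 _ (by decide)).trans hsize⟩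
  · rintro v τ - hv ⟨hF, hi, h⟩
    have e1 := hF.2 .plus (by decide)
    have e2 := hF.2 .minus (by decide)
    refine .load (.load (.branch_eq (B := 1) (B' := 0) (fun hx => ?_) fun hx => ?_))
    · simp [Store.setReg_reg, Store.setReg_arr, hi, e1, e2] at hx
      refine .nil (.nil ⟨?_, ?_, ?_⟩)
      · exact ((hF.setReg (by decide) _).setReg (by decide) _).setReg (by decide) _
      · simp [Store.setReg_reg, hi]
      · simp only [Nat.forall_lt_succ_right]
        simp [Store.setReg_reg, *]
    · simp [Store.setReg_reg, Store.setReg_arr, hi, e1, e2] at hx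
      refine .zero (.nil (.nil ⟨?_, ?_, ?_⟩))
      · exact (((hF.setReg (by decide) _).setReg (by decide) _).setReg (by decide) _).setReg
          (by decide) _
      · simp [Store.setReg_reg, hi]
      · simp only [Nat.forall_lt_succ_right]
        simp [Store.setReg_reg, *]

end Counters

/-- The registers that hold constants have the right contents. -/
structure HasConstants (r d n : ℕ) (σ : Store Var Arr) : Prop where
  rank : σ.reg .rank = r
  cls : σ.reg .cls = d
  len : σ.reg .len = n
  nul : σ.reg .nul = 0
  one : σ.reg .one = 1
  size : σ.reg .size = n + 1

theorem Frame.hasConstants {R : List Var} {S : List Arr} {σ τ : Store Var Arr} {r d n : ℕ}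
    (h : Frame R S σ τ) (hσ : HasConstants r d n σ)
    (hR : ∀ z ∈ [Var.rank, .cls, .len, .nul, .one, .size], z ∉ R) : HasConstants r d n τ where
  rank := (h.1 _ (hR _ (by decide))).trans hσ.rank
  cls := (h.1 _ (hR _ (by decide))).trans hσ.cls
  len := (h.1 _ (hR _ (by decide))).trans hσ.len
  nul := (h.1 _ (hR _ (by decide))).trans hσ.nul
  one := (h.1 _ (hR _ (by decide))).trans hσ.one
  size := (h.1 _ (hR _ (by decide))).trans hσ.size

/-! ### One refinement of the partition. -/

section Refinement

variable {r d n s t : ℕ} {σ : Store Var Arr}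

theorem compareDerivatives_spec (hσ : HasConstants r d n σ) (hs : σ.reg .s = s)
    (ht : σ.reg .t = t) (hst : s ≤ t) (htn : t ≤ n) :
    RunsWithin compareDerivatives σ (r * (22 * (n + 1) + 8) + 4) fun τ =>
      Frame [.k, .i, .j, .x, .y, .p, .q, .flag] [.plus, .minus] σ τ ∧
      (τ.reg .flag = 1 ↔ Balanced r n (σ.arr .letter) (σ.arr .sign) (σ.arr .part) s t) := by
  rw [compareDerivatives_eq]
  refine .zero (.inc (.mono (RunsWithin.forLoop (B := 22 * (n + 1) + 6) (h := r) (fun v τ =>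
    Frame [.k, .i, .j, .x, .y, .p, .q, .flag] [.plus, .minus] σ τ ∧ τ.reg .k = v ∧
      (τ.reg .flag = 1 ↔ Balanced v n (σ.arr .letter) (σ.arr .sign) (σ.arr .part) s t))
    (l := 0) ?_ (Nat.zero_le _) ?_ ?_ ?_) (by ring_nf; omega) fun τ hτ => ⟨hτ.1, hτ.2.2⟩))
  · simp [Store.setReg_reg, hσ.nul]
  · refine ⟨?_, by simp [Store.setReg_reg], by simp [Store.setReg_reg, Balanced]⟩
    exact (((Frame.refl _ _ _).setReg (by decide) _).setReg (by decide) _).setReg (by decide) _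
  · rintro v τ ⟨hF, hk, -⟩
    exact ⟨hk, (hF.hasConstants hσ (by decide)).rank⟩
  · rintro v τ - hv ⟨hF, hk, hflag⟩
    have hτ := hF.hasConstants hσ (by decide)
    -- The costs of clearing, counting and comparing; with `t ≤ n` they add up to at most `22 * (n +
    -- 1) + 6`.
    refine .mono (B := 4 * (n + 1) + 2 + (12 * t + 2) + (6 * (n + 1) + 2))
      (.append (.append ((clearCounters_spec hτ.nul hτ.size).mono le_rfl ?_))) (by omega)
      fun _ h => h
    rintro τ₁ ⟨hF₁, h0⟩
    have hF₁' := hF.trans (hF₁.mono (by decide) (by decide))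
    refine (countTerms_spec (hF₁'.hasConstants hσ (by decide)).one
      ((hF₁'.1 _ (by decide)).trans hs) ((hF₁'.1 _ (by decide)).trans ht)
      ((hF₁.1 _ (by decide)).trans hk) hst h0).mono le_rfl ?_
    rintro τ₂ ⟨hF₂, hc⟩
    have hF₂' := hF₁'.trans (hF₂.mono (by decide) (by decide))
    have hτ₂ := hF₂'.hasConstants hσ (by decide)
    refine (compareCounters_spec hτ₂.nul hτ₂.size).mono le_rfl ?_
    rintro τ₃ ⟨hF₃, hflag₃⟩
    have hk₃ : τ₃.reg .k = v := by
      rw [hF₃.1 _ (by decide), hF₂.1 _ (by decide), hF₁.1 _ (by decide), hk]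
    refine ⟨(hF₂'.trans (hF₃.mono (by decide) (by decide))).setReg (by decide) _,
      by simp [Store.setReg_reg, hk₃], ?_⟩
    have e : (∀ p ≤ n, τ₂.arr .plus p = τ₂.arr .minus p) ↔ ∀ p ≤ n,
        plusCount (σ.arr .letter) (σ.arr .sign) (σ.arr .part) s t v p =
          minusCount (σ.arr .letter) (σ.arr .sign) (σ.arr .part) s t v p := by
      refine forall₂_congr fun p hp => ?_
      rw [(hc p hp).1, (hc p hp).2, hF₁'.2 _ (by decide), hF₁'.2 _ (by decide),
        hF₁'.2 _ (by decide)]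
    simp only [Balanced, Nat.forall_lt_succ_right] at hflag ⊢
    rw [← e, ← hflag]
    simp [Store.setReg_reg, hflag₃, hF₂.1 .flag (by decide), hF₁.1 .flag (by decide)]

/-- The criterion by which the algorithm decides that two prefixes are equal in the next group. -/
def Merged (r n : ℕ) (L S P : ℕ → ℕ) (s t : ℕ) : Prop :=
  P s = P t ∧ Balanced r n L S P s t

/-- The candidates for the value of the next partition function at `t` after comparison of
`t` with all `i < v`. -/
def candidates (r n : ℕ) (L S P : ℕ → ℕ) (t v : ℕ) : Set ℕ :=
  {i | (i < v ∧ Merged r n L S P i t) ∨ i = t}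

/-- The comparison of two prefixes. -/
def comparePrefixes : List (Cmd Var Arr) :=
  [.load .x .part .s, .load .y .part .t,
    .branch (.eq .x .y)
      (compareDerivatives ++
        [.branch (.eq .flag .one)
          [.load .x .next .t, .branch (.eq .x .t) [.store .next .t .s] []] []]) []]

/-- The computation of one value of the next partition function. -/
def refineRow : List (Cmd Var Arr) :=
  [.store .next .t .t] ++ forLoop .s .nul .t comparePrefixes

theorem refinePartition_eq :
    refinePartition = forLoop .t .nul .size refineRow ++
      forLoop .i .nul .size [.load .x .next .i, .store .part .i .x] := rfl

theorem candidates_succ_of_merged {L S P : ℕ → ℕ} (h : Merged r n L S P s t) :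
    candidates r n L S P t (s + 1) = insert s (candidates r n L S P t s) := by
  ext i
  simp only [candidates, Set.mem_ofPred_eq, Set.mem_insert_iff, Nat.lt_succ_iff_lt_or_eq]
  grind

theorem candidates_succ_of_not_merged {L S P : ℕ → ℕ} (h : ¬ Merged r n L S P s t) :
    candidates r n L S P t (s + 1) = candidates r n L S P t s := by
  ext i
  simp only [candidates, Set.mem_ofPred_eq, Nat.lt_succ_iff_lt_or_eq]
  grind

/-- Since `s` increases, the first success is the least. The code therefore overwrites `next[t]`
only while it still has its initial value `t`, and both cases agree with the minimum of `s` and the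
old value. -/
theorem comparePrefixes_spec (hσ : HasConstants r d n σ) (hs : σ.reg .s = s)
    (ht : σ.reg .t = t) (hst : s < t) (htn : t ≤ n)
    (hnext : IsLeast (candidates r n (σ.arr .letter) (σ.arr .sign) (σ.arr .part) t s)
      (σ.arr .next t)) :
    RunsWithin comparePrefixes σ (r * (22 * (n + 1) + 8) + 11) fun τ =>
      Frame [.k, .i, .j, .x, .y, .p, .q, .flag] [.plus, .minus, .next] σ τ ∧
      (∀ t' ≠ t, τ.arr .next t' = σ.arr .next t') ∧
      IsLeast (candidates r n (σ.arr .letter) (σ.arr .sign) (σ.arr .part) t (s + 1))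
        (τ.arr .next t) := by
  refine .load (.load (.branch_eq (B := r * (22 * (n + 1) + 8) + 4 + 4) (B' := 0) (fun hx => ?_)
    fun hx => ?_))
  · simp only [Store.setReg_reg, Store.setReg_arr, hs, ht, reduceCtorEq, if_true, if_false] at hx
    set σ' := (σ.setReg .x (σ.arr .part (σ.reg .s))).setReg .y
      ((σ.setReg .x (σ.arr .part (σ.reg .s))).arr .part
        ((σ.setReg .x (σ.arr .part (σ.reg .s))).reg .t))
    have hF : Frame [.k, .i, .j, .x, .y, .p, .q, .flag] [.plus, .minus] σ σ' :=
      ((Frame.refl _ _ _).setReg (by decide) _).setReg (by decide) _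
    refine .append ((compareDerivatives_spec (hF.hasConstants hσ (by decide))
      ((hF.1 _ (by decide)).trans hs) ((hF.1 _ (by decide)).trans ht) hst.le htn).mono le_rfl ?_)
    rintro τ ⟨hF', hflag⟩
    have hF' := hF.trans hF'
    rw [hF.2 _ (by decide), hF.2 _ (by decide), hF.2 _ (by decide)] at hflag
    have hone := (hF'.hasConstants hσ (by decide)).one
    have htt : τ.reg .t = t := (hF'.1 _ (by decide)).trans ht
    have hss : τ.reg .s = s := (hF'.1 _ (by decide)).trans hs
    have hnn := hF'.2 .next (by decide)
    have hF'' := hF'.mono (List.Subset.refl _) (S' := [.plus, .minus, .next]) (by decide)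
    refine .branch_eq (B := 3) (B' := 0) (fun hf => ?_) fun hf => ?_
    · rw [hone, hflag] at hf
      have hm : Merged r n (σ.arr .letter) (σ.arr .sign) (σ.arr .part) s t := ⟨hx, hf⟩
      rw [candidates_succ_of_merged hm]
      refine .load (.branch_eq (B := 1) (B' := 0) (fun hy => ?_) fun hy => ?_)
      · simp only [Store.setReg_reg, htt, hnn, reduceCtorEq, if_true, if_false] at hy
        refine .store (.nil (.nil (.nil (.nil ⟨?_, ?_, ?_⟩))))
        · exact (hF''.setReg (by decide) _).setArr (by decide) _ _
        · intro t' ht'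
          simp [Store.setReg_reg, Store.setReg_arr, Store.setArr_arr, htt, hnn, ht']
        · rw [hy] at hnext
          simpa [Store.setReg_reg, Store.setReg_arr, Store.setArr_arr, htt, hss, hst.le]
            using hnext.insert s
      · simp only [Store.setReg_reg, htt, hnn, reduceCtorEq, if_true, if_false] at hy
        refine .nil (.nil (.nil (.nil ⟨?_, ?_, ?_⟩)))
        · exact hF''.setReg (by decide) _
        · intro t' _
          simp [Store.setReg_arr, hnn]
        · have hlt : σ.arr .next t ≤ s := by
            rcases hnext.1 with h | h
            · exact h.1.le
            · exact absurd h hy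
          simpa [Store.setReg_arr, hnn, hlt] using hnext.insert s
    · rw [hone, ne_eq, hflag] at hf
      rw [candidates_succ_of_not_merged fun h => hf h.2]
      exact .nil (.nil (.nil ⟨hF'', fun _ _ => by rw [hnn], by rwa [hnn]⟩))
  · simp only [Store.setReg_reg, Store.setReg_arr, hs, ht, reduceCtorEq, if_true, if_false] at hx
    rw [candidates_succ_of_not_merged fun h => hx h.1]
    exact .nil (.nil ⟨((Frame.refl _ _ _).setReg (by decide) _).setReg (by decide) _,
      fun _ _ => rfl, hnext⟩)

theorem refineRow_spec (hσ : HasConstants r d n σ) (ht : σ.reg .t = t) (htn : t ≤ n) :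
    RunsWithin refineRow σ (t * (r * (22 * (n + 1) + 8) + 13) + 3) fun τ =>
      Frame [.s, .k, .i, .j, .x, .y, .p, .q, .flag] [.plus, .minus, .next] σ τ ∧
      (∀ t' ≠ t, τ.arr .next t' = σ.arr .next t') ∧
      IsLeast (candidates r n (σ.arr .letter) (σ.arr .sign) (σ.arr .part) t t)
        (τ.arr .next t) := by
  refine .store (.mono (RunsWithin.forLoop (B := r * (22 * (n + 1) + 8) + 11) (h := t) (fun v τ =>
    Frame [.s, .k, .i, .j, .x, .y, .p, .q, .flag] [.plus, .minus, .next] σ τ ∧ τ.reg .s = v ∧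
      (∀ t' ≠ t, τ.arr .next t' = σ.arr .next t') ∧
      IsLeast (candidates r n (σ.arr .letter) (σ.arr .sign) (σ.arr .part) t v)
        (τ.arr .next t)) (l := 0) ?_ (Nat.zero_le _) ?_ ?_ ?_) (by ring_nf; omega)
        fun τ hτ => ⟨hτ.1, hτ.2.2⟩)
  · simp [Store.setArr_reg, hσ.nul]
  · refine ⟨((Frame.refl _ _ _).setArr (by decide) _ _).setReg (by decide) _,
      by simp [Store.setReg_reg], fun t' ht' => ?_, ?_⟩
    · simp [Store.setReg_arr, Store.setArr_arr, ht, ht']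
    · simp [Store.setReg_arr, Store.setArr_arr, ht, candidates]
  · rintro v τ ⟨hF, hv, -⟩
    exact ⟨hv, (hF.1 _ (by decide)).trans ht⟩
  · rintro v τ - hv ⟨hF, hs, hne, hnext⟩
    have e1 := hF.2 .letter (by decide)
    have e2 := hF.2 .sign (by decide)
    have e3 := hF.2 .part (by decide)
    refine (comparePrefixes_spec (hF.hasConstants hσ (by decide)) hs
      ((hF.1 _ (by decide)).trans ht) hv htn (by rwa [e1, e2, e3])).mono le_rfl ?_
    rintro τ' ⟨hF', hne', hnext'⟩
    rw [e1, e2, e3] at hnext'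
    refine ⟨(hF.trans (hF'.mono (by decide) (by decide))).setReg (by decide) _, ?_, ?_, hnext'⟩
    · simp [Store.setReg_reg, hF'.1 .s (by decide), hs]
    · exact fun t' ht' => (hne' t' ht').trans (hne t' ht')

/-- Every comparison must use the old partition, so `part` is kept outside the frame of the first
loop and is replaced by `next` only when all rows are complete. -/
theorem refinePartition_spec (hσ : HasConstants r d n σ) :
    RunsWithin refinePartition σ
      ((n + 1) * (n * (r * (22 * (n + 1) + 8) + 13) + 5) + 4 * (n + 1) + 4) fun τ =>
      Frame [.t, .s, .k, .i, .j, .x, .y, .p, .q, .flag] [.plus, .minus, .next, .part] σ τ ∧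
      ∀ t ≤ n, IsLeast (candidates r n (σ.arr .letter) (σ.arr .sign) (σ.arr .part) t t)
        (τ.arr .part t) := by
  rw [refinePartition_eq]
  refine .mono (.append (.mono (RunsWithin.forLoop (B := n * (r * (22 * (n + 1) + 8) + 13) + 3)
    (h := n + 1) (fun v τ =>
      Frame [.t, .s, .k, .i, .j, .x, .y, .p, .q, .flag] [.plus, .minus, .next] σ τ ∧
      τ.reg .t = v ∧ ∀ t < v,
        IsLeast (candidates r n (σ.arr .letter) (σ.arr .sign) (σ.arr .part) t t)
        (τ.arr .next t)) (l := 0) hσ.nul (Nat.zero_le _) ?_ ?_ ?_) le_rfl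
    fun τ hτ => .mono (RunsWithin.forLoop (B := 2)
    (h := n + 1) (fun v τ' =>
      Frame [.t, .s, .k, .i, .j, .x, .y, .p, .q, .flag] [.plus, .minus, .next, .part] σ τ' ∧
      τ'.reg .i = v ∧ (∀ t, τ'.arr .next t = τ.arr .next t) ∧
      ∀ t < v, τ'.arr .part t = τ.arr .next t)
      (l := 0) (hτ.1.hasConstants hσ (by decide)).nul (Nat.zero_le _) ?_ ?_ ?_) le_rfl
    fun τ' hτ' => ⟨hτ'.1, fun t ht => ?_⟩)) (by ring_nf; omega) fun _ h => h
  · exact ⟨(Frame.refl _ _ _).setReg (by decide) _, by simp [Store.setReg_reg], by simp⟩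
  · rintro v τ ⟨hF, hv, -⟩
    exact ⟨hv, (hF.hasConstants hσ (by decide)).size⟩
  · rintro v τ - hv ⟨hF, ht, hnext⟩
    have e1 := hF.2 .letter (by decide)
    have e2 := hF.2 .sign (by decide)
    have e3 := hF.2 .part (by decide)
    have hvn : v ≤ n := by omega
    refine (refineRow_spec (hF.hasConstants hσ (by decide)) ht hvn).mono (by gcongr) ?_
    rintro τ' ⟨hF', hne', hnext'⟩
    rw [e1, e2, e3] at hnext'
    refine ⟨(hF.trans (hF'.mono (by decide) (by decide))).setReg (by decide) _, ?_, ?_⟩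
    · simp [Store.setReg_reg, hF'.1 .t (by decide), ht]
    · intro t' ht'
      rcases Nat.lt_succ_iff_lt_or_eq.1 ht' with h | rfl
      · rw [Store.setReg_arr, hne' t' h.ne]
        exact hnext t' h
      · exact hnext'
  · exact ⟨(hτ.1.mono (List.Subset.refl _) (by decide)).setReg (by decide) _,
      by simp [Store.setReg_reg], fun _ => rfl, by simp⟩
  · rintro v τ ⟨hF, hv, -⟩
    exact ⟨hv, (hF.hasConstants hσ (by decide)).size⟩
  · rintro v τ' - hv ⟨hF, hi, hnext, hpart⟩
    refine .load (.store (.nil (B := 0) ⟨?_, ?_, fun t => ?_, fun t ht => ?_⟩))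
    · exact ((hF.setReg (by decide) _).setArr (by decide) _ _).setReg (by decide) _
    · simp [Store.setReg_reg, Store.setArr_reg, hi]
    · simp [Store.setReg_arr, Store.setArr_arr, hnext]
    · rcases Nat.lt_succ_iff_lt_or_eq.1 ht with h | rfl
      · simp [Store.setReg_reg, Store.setReg_arr, Store.setArr_arr, hi, h.ne, hpart t h]
      · simp [Store.setReg_reg, Store.setReg_arr, Store.setArr_arr, hi, hnext]
  · rw [hτ'.2.2.2 t (by omega)]
    exact hτ.2.2 t (by omega)

end Refinement

/-! ### Correctness of the refinement -/

section Word

variable {r c : ℕ} {w : List (Fin r × Bool)}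

theorem IsPartitionFunction.eq_iff {P : ℕ → ℕ} (hP : IsPartitionFunction r c w P) {i j : ℕ}
    (hi : i ≤ w.length) (hj : j ≤ w.length) :
    P i = P j ↔ wordElt r c (w.take i) = wordElt r c (w.take j) := by
  constructor
  · intro h
    rw [← (hP i hi).1.2, h, (hP j hj).1.2]
  · intro h
    have := hP i hi
    rw [h] at this
    exact this.unique (hP j hj)

theorem IsPartitionFunction.congr {P Q : ℕ → ℕ} (hP : IsPartitionFunction r c w P)
    (h : ∀ j ≤ w.length, Q j = P j) : IsPartitionFunction r c w Q :=
  fun j hj => (h j hj).symm ▸ hP j hj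

theorem isPartitionFunction_zero : IsPartitionFunction r 0 w fun _ => 0 := by
  refine fun j _ => ⟨⟨Nat.zero_le _, ?_⟩, fun _ _ => Nat.zero_le _⟩
  refine (QuotientGroup.eq).2 ?_
  rw [derivedSeries_zero]
  trivial

/-- The generators of the free group, indexed by natural numbers. -/
def generator (r k : ℕ) : FreeGroup (Fin r) :=
  if h : k < r then FreeGroup.of ⟨k, h⟩ else 1

/-- The element of the free group that is represented by a prefix of `w`. -/
def prefixElt (w : List (Fin r × Bool)) (j : ℕ) : FreeGroup (Fin r) :=
  FreeGroup.mk (w.take j)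

theorem input_letter (d : ℕ) {j : ℕ} (hj : j < w.length) :
    (input r d w).arr .letter j = w[j].1 := by
  simp [input, hj]

theorem input_sign (d : ℕ) {j : ℕ} (hj : j < w.length) :
    (input r d w).arr .sign j = w[j].2.toNat := by
  simp [input, hj]

theorem isPath_prefixElt (d : ℕ) {s t : ℕ} (ht : t ≤ w.length) :
    IsPath (generator r) (prefixElt w) ((input r d w).arr .letter)
      (fun j => (input r d w).arr .sign j = 1) s t := by
  intro j hj
  have hj' : j < w.length := (mem_Ico.1 hj).2.trans_le ht
  have hx : generator r ((input r d w).arr .letter j) = FreeGroup.of w[j].1 := by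
    simp [generator, input_letter d hj']
  have hu : prefixElt w (j + 1) = prefixElt w j * FreeGroup.mk [w[j]] := by
    rw [prefixElt, prefixElt, FreeGroup.mul_mk, List.take_append_getElem]
  beta_reduce
  rw [hx, hu, input_sign d hj']
  obtain ⟨k, b⟩ := w[j]
  cases b
  · refine ⟨by simp, fun _ => ?_⟩
    exact (inv_mul_cancel_right (prefixElt w j) (FreeGroup.of k)).symm
  · exact ⟨fun _ => rfl, by simp⟩

/-- Equality of cosets of prefixes is equality of `P`-values, so the terms match one by one. The
flow is the change from `s` to `t`, while the program forms the derivative at `s` minus that at `t`;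
hence `minusCount` comes with the positive sign. -/
theorem sum_flowAt_prefixElt {P L S : ℕ → ℕ} (hP : IsPartitionFunction r c w P) {s t i : ℕ}
    (ht : t ≤ w.length) (hi : i ≤ w.length) (k : ℕ) :
    ∑ j ∈ Ico s t, flowAt (derivedSeries (FreeGroup (Fin r)) c) (prefixElt w) L
      (fun j => S j = 1) k (prefixElt w i : FreeSolvableGroup r c) j =
      (minusCount L S P s t k (P i) : ℤ) - plusCount L S P s t k (P i) := by
  classical
  rw [minusCount, plusCount, Nat.cast_sum, Nat.cast_sum, ← sum_sub_distrib]
  refine sum_congr rfl fun j hj => ?_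
  have hj' : j < w.length := (mem_Ico.1 hj).2.trans_le ht
  have h1 : P j = P i ↔ (prefixElt w j : FreeSolvableGroup r c) = prefixElt w i :=
    hP.eq_iff hj'.le hi
  have h2 : P (j + 1) = P i ↔ (prefixElt w (j + 1) : FreeSolvableGroup r c) = prefixElt w i :=
    hP.eq_iff hj' hi
  simp only [flowAt, ne_eq, Nat.cast_ite, Nat.cast_one, Nat.cast_zero]
  congr 1 <;> split_ifs <;> first | rfl | (exfalso; tauto)

/-- Finitely many coefficients suffice: a coset that contains no prefix carries no flow, and a
number that is not a value of `P` has both counts zero. -/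
theorem balanced_iff {P : ℕ → ℕ} (hP : IsPartitionFunction r c w P) (d : ℕ) {s t : ℕ}
    (ht : t ≤ w.length) :
    Balanced r w.length ((input r d w).arr .letter) ((input r d w).arr .sign) P s t ↔
      ∀ k < r, ∀ g, ∑ j ∈ Ico s t, flowAt (derivedSeries (FreeGroup (Fin r)) c) (prefixElt w)
        ((input r d w).arr .letter) (fun j => (input r d w).arr .sign j = 1) k g j = 0 := by
  refine forall₂_congr fun k _ => ⟨fun h g => ?_, fun h p hp => ?_⟩
  · by_cases hg : ∃ i ≤ w.length, (prefixElt w i : FreeSolvableGroup r c) = g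
    · obtain ⟨i, hi, rfl⟩ := hg
      rw [sum_flowAt_prefixElt hP ht hi, h (P i) (hP i hi).1.1, sub_self]
    · push Not at hg
      refine sum_eq_zero fun j hj => ?_
      have hj' : j < w.length := (mem_Ico.1 hj).2.trans_le ht
      simp [flowAt, hg j hj'.le, hg (j + 1) hj']
  · by_cases hg : ∃ i ≤ w.length, P i = p
    · obtain ⟨i, hi, rfl⟩ := hg
      have := h (prefixElt w i)
      rw [sum_flowAt_prefixElt hP ht hi] at this
      omega
    · push Not at hg
      rw [plusCount, minusCount, sum_eq_zero, sum_eq_zero]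
      · intro j hj
        simp [hg j ((mem_Ico.1 hj).2.trans_le ht).le]
      · intro j hj
        simp [hg (j + 1) ((mem_Ico.1 hj).2.trans_le ht)]

/-- The flow criterion applied to the `c`-th derived subgroup, whose commutator subgroup is by
definition the next one. Labels `k ≥ r` occur nowhere in `w` and carry no flow. -/
theorem merged_iff {P : ℕ → ℕ} (hP : IsPartitionFunction r c w P) (d : ℕ) {s t : ℕ}
    (hst : s ≤ t) (ht : t ≤ w.length) :
    Merged r w.length ((input r d w).arr .letter) ((input r d w).arr .sign) P s t ↔
      wordElt r (c + 1) (w.take s) = wordElt r (c + 1) (w.take t) := by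
  have hpath := isPath_prefixElt d (s := s) ht
  have hsucc : wordElt r (c + 1) (w.take s) = wordElt r (c + 1) (w.take t) ↔
      (prefixElt w s)⁻¹ * prefixElt w t ∈ ⁅derivedSeries (FreeGroup (Fin r)) c,
        derivedSeries (FreeGroup (Fin r)) c⁆ := QuotientGroup.eq
  have hletter : ∀ j ∈ Ico s t, (input r d w).arr .letter j < r := fun j hj => by
    rw [input_letter d ((mem_Ico.1 hj).2.trans_le ht)]
    exact Fin.is_lt _
  rw [Merged, balanced_iff hP d ht, hP.eq_iff (hst.trans ht) ht, hsucc]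
  constructor
  · rintro ⟨hN, h0⟩
    refine mem_commutator_of_flow_eq_zero _ hst hpath hN fun k g => ?_
    by_cases hk : k < r
    · exact h0 k hk g
    · refine sum_eq_zero fun j hj => ?_
      have : (input r d w).arr .letter j ≠ k := fun h => hk (h ▸ hletter j hj)
      simp [flowAt, this]
  · intro h
    refine ⟨QuotientGroup.eq.2 (Subgroup.commutator_le_left _ _ h), fun k hk g => ?_⟩
    refine flow_eq_zero_of_mem_commutator _ hst hpath (i := ⟨k, hk⟩) (fun j hj => ?_) h g
    exact ⟨⟨_, hletter j hj⟩, by simp [generator, hletter j hj], by simp⟩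

theorem isPartitionFunction_succ {P Q : ℕ → ℕ} (hP : IsPartitionFunction r c w P) (d : ℕ)
    (hQ : ∀ t ≤ w.length, IsLeast (candidates r w.length ((input r d w).arr .letter)
      ((input r d w).arr .sign) P t t) (Q t)) : IsPartitionFunction r (c + 1) w Q := by
  intro t ht
  obtain ⟨hmem, hle⟩ := hQ t ht
  have htt : Q t ≤ t := hle (Or.inr rfl)
  refine ⟨⟨htt.trans ht, ?_⟩, ?_⟩
  · rcases hmem with ⟨_, h⟩ | h
    · exact (merged_iff hP d htt ht).1 h
    · rw [h]
  -- Only `i < t` were tested, but `Q t ≤ t` disposes of the others.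
  · rintro i ⟨_, hi⟩
    rcases lt_or_ge i t with h | h
    · exact hle (Or.inl ⟨h, (merged_iff hP d h.le ht).2 hi⟩)
    · exact htt.trans h

end Word

/-! ### The whole program -/

section Main

variable {r d : ℕ} {w : List (Fin r × Bool)}

/-- The state of the memory after `c` refinements. -/
structure IsRefined (r d : ℕ) (w : List (Fin r × Bool)) (c : ℕ) (σ : Store Var Arr) : Prop where
  const : HasConstants r d w.length σ
  letter : σ.arr .letter = (input r d w).arr .letter
  sign : σ.arr .sign = (input r d w).arr .sign
  counter : σ.reg .c = c
  part : IsPartitionFunction r c w (σ.arr .part)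

theorem setUp_spec :
    RunsWithin (setUp ++ [.copy .c .nul]) (input r d w) (3 * (w.length + 1) + 8)
      (IsRefined r d w 0) := by
  let σ : Store Var Arr := (((((input r d w).setReg .nul 0).setReg .one 0).setReg .one 1).setReg
    .size w.length).setReg .size (w.length + 1)
  have hσ : HasConstants r d w.length σ := by
    constructor <;> simp [σ, Store.setReg_reg, input]
  refine .append (B := 3 * (w.length + 1) + 7) (B' := 1)
    (.zero (.zero (.inc (.copy (.inc (.mono (RunsWithin.forLoop (B := 1)
    (h := w.length + 1) (fun v τ => Frame [.i] [.part] σ τ ∧ τ.reg .i = v ∧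
      ∀ j < v, τ.arr .part j = 0) (l := 0) ?_ (Nat.zero_le _) ?_ ?_ ?_) (by ring_nf; omega)
      fun τ hτ => ?_))))))
  · simp [Store.setReg_reg]
  · refine ⟨Frame.setReg ⟨fun z _ => ?_, fun _ _ => rfl⟩ (by decide) _,
      by simp [Store.setReg_reg], by simp⟩
    simp [σ, Store.setReg_reg, input]
  · rintro v τ ⟨hF, hv, -⟩
    exact ⟨hv, (hF.hasConstants hσ (by decide)).size⟩
  · rintro v τ - hv ⟨hF, hi, hpart⟩
    refine .store (.nil (B := 0) ⟨?_, ?_, fun j hj => ?_⟩)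
    · exact (hF.setArr (by decide) _ _).setReg (by decide) _
    · simp [Store.setReg_reg, Store.setArr_reg, hi]
    · have hnul := (hF.hasConstants hσ (by decide)).nul
      rcases Nat.lt_succ_iff_lt_or_eq.1 hj with h | rfl
      · simp [Store.setReg_arr, Store.setArr_arr, hnul, hpart j h]
      · simp [Store.setReg_arr, Store.setArr_arr, hnul, hi]
  · obtain ⟨hF, -, hpart⟩ := hτ
    have hτ := hF.hasConstants hσ (by decide)
    refine .copy (.nil ?_)
    exact {
      const := ((Frame.refl [.c] [] τ).setReg (by decide) _).hasConstants hτ (by decide)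
      letter := hF.2 _ (by decide)
      sign := hF.2 _ (by decide)
      counter := by simp [Store.setReg_reg, hτ.nul]
      part := isPartitionFunction_zero.congr fun j hj => hpart j (by omega) }

/-- A bound for the duration of one refinement. -/
def refineTime (r n : ℕ) : ℕ :=
  (n + 1) * (n * (r * (22 * (n + 1) + 8) + 13) + 5) + 4 * (n + 1) + 4

theorem refine_and_count_spec {c : ℕ} {σ : Store Var Arr} (hσ : IsRefined r d w c σ) :
    RunsWithin (refinePartition ++ [.inc .c]) σ (refineTime r w.length + 1)
      (IsRefined r d w (c + 1)) := by
  refine .append ((refinePartition_spec hσ.const).mono le_rfl ?_)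
  rintro τ ⟨hF, hpart⟩
  rw [hσ.letter, hσ.sign] at hpart
  refine .inc (.nil ?_)
  exact {
    const := ((hF.mono (List.subset_cons_self .c _) (List.Subset.refl _)).setReg (by decide)
      _).hasConstants hσ.const (by decide)
    letter := (hF.2 _ (by decide)).trans hσ.letter
    sign := (hF.2 _ (by decide)).trans hσ.sign
    counter := by simp [Store.setReg_reg, hF.1 .c (by decide), hσ.counter]
    part := isPartitionFunction_succ hσ.part d hpart }

theorem answer_spec {c : ℕ} {σ : Store Var Arr} (hσ : IsRefined r d w c σ) :
    RunsWithin answer σ 4 fun τ =>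
      (wordElt r c w = 1 → τ.reg .out = 1) ∧ (wordElt r c w ≠ 1 → τ.reg .out = 0) := by
  have h := hσ.part.eq_iff (Nat.zero_le _) le_rfl
  have h1 : wordElt r c (w.take 0) = 1 := rfl
  rw [List.take_length, h1, eq_comm (a := (1 : FreeSolvableGroup r c))] at h
  refine .load (.load (.branch_eq (B := 1) (B' := 0) (fun hx => ?_) fun hx => ?_))
  all_goals
    simp only [Store.setReg_reg, Store.setReg_arr, hσ.const.nul, hσ.const.len, reduceCtorEq,
      if_true, if_false, ne_eq, h] at hx
    refine .copy (.nil (.nil ?_))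
    simp [Store.setReg_reg, hσ.const.nul, hσ.const.one, hx]

/-- Recording the visits to the loop head gives both the final state, for `c = d`, and the
intermediate partitions. Each round adds the loop test to `refineTime r w.length + 1`. -/
theorem exists_reachesIn_mainLoop {c : ℕ} (hc : c ≤ d) :
    ∃ m ≤ 3 * (w.length + 1) + 8 + c * (refineTime r w.length + 2), ∃ τ,
      ReachesIn m (wpSolvable, input r d w) (mainLoop :: answer, τ) ∧ IsRefined r d w c τ := by
  induction c with
  | zero =>
    obtain ⟨m, hm, τ, hr, hτ⟩ := setUp_spec (r := r) (d := d) (w := w)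
    exact ⟨m, by omega, τ, hr _, hτ⟩
  | succ c ih =>
    obtain ⟨m, hm, τ, hr, hτ⟩ := ih (by omega)
    obtain ⟨m', hm', τ', hr', hτ'⟩ := refine_and_count_spec hτ
    refine ⟨m + 1 + m', by rw [add_mul c 1]; omega, τ', ?_, hτ'⟩
    refine (hr.trans (.of_step ?_)).trans (hr' (mainLoop :: answer))
    have : c < d := by omega
    simp [mainLoop, step, Test.holds, hτ.counter, hτ.const.cls, this]

/-- With `n + 1 ≤ 2 * M`, every lower-order term is absorbed into the leading one; the constants
grow as `65`, `70`, `140` and finally `140 + 8 + 6`. -/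
theorem refineTime_le (hr : 1 ≤ r) (n : ℕ) : refineTime r n + 2 ≤ 154 * (r * max n 1 ^ 3) := by
  set M := max n 1
  have hM : 1 ≤ M := le_max_right _ _
  have hn : n ≤ M := le_max_left _ _
  have hn1 : n + 1 ≤ 2 * M := by omega
  have hrM : 1 ≤ r * M := Nat.mul_pos hr hM
  have hrM2 : 1 ≤ r * M ^ 2 := Nat.mul_pos hr (pow_pos hM 2)
  have hM3 : M ≤ r * M ^ 3 := by
    calc M = 1 * M * 1 := by ring
      _ ≤ r * M * M ^ 2 := by gcongr; exact Nat.one_le_pow _ _ hM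
      _ = r * M ^ 3 := by ring
  have h1 : r * (22 * (n + 1) + 8) + 13 ≤ 65 * (r * M) := by
    calc r * (22 * (n + 1) + 8) + 13 ≤ r * (22 * (2 * M) + 8 * M) + 13 * (r * M) := by
          gcongr <;> omega
      _ = 65 * (r * M) := by ring
  have h2 : n * (r * (22 * (n + 1) + 8) + 13) + 5 ≤ 70 * (r * M ^ 2) := by
    calc n * (r * (22 * (n + 1) + 8) + 13) + 5 ≤ M * (65 * (r * M)) + 5 * (r * M ^ 2) := by
          gcongr; omega
      _ = 70 * (r * M ^ 2) := by ring
  calc refineTime r n + 2 ≤ 2 * M * (70 * (r * M ^ 2)) + 4 * (2 * M) + 4 + 2 := by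
        rw [refineTime]; gcongr
    _ = 140 * (r * M ^ 3) + 8 * M + 6 := by ring
    _ ≤ 154 * (r * M ^ 3) := by omega

end Main

end FreeSolvableWP

theorem mainTheorem6 :
    ∃ C : ℕ, ∀ (r d : ℕ), 2 ≤ r → 2 ≤ d → ∀ w : List (Fin r × Bool),
      ∃ (T : ℕ) (σ : FreeSolvableWP.Store FreeSolvableWP.Var FreeSolvableWP.Arr),
        -- the program halts on input `r, d, w` after exactly `T` steps, in time `O(d r |w|³)`,
        FreeSolvableWP.ReachesIn T
          (FreeSolvableWP.wpSolvable, FreeSolvableWP.input r d w) ([], σ) ∧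
        T ≤ C * d * r * (max w.length 1) ^ 3 ∧
        -- it answers correctly whether `w = 1` in `S_{r,d}`,
        (FreeSolvableWP.wordElt r d w = 1 → σ.reg .out = 1) ∧
        (FreeSolvableWP.wordElt r d w ≠ 1 → σ.reg .out = 0) ∧
        -- and in the course of the computation it finds the `S_{r,c}`-partitions,
        -- `c = 1, …, d`, of the set of prefixes of `w` after `c` refinements.
        ∀ c, 1 ≤ c → c ≤ d → ∃ m ≤ T, ∃ τ,
          FreeSolvableWP.ReachesIn m
            (FreeSolvableWP.wpSolvable, FreeSolvableWP.input r d w)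
            (FreeSolvableWP.mainLoop :: FreeSolvableWP.answer, τ) ∧
          τ.reg .c = c ∧ FreeSolvableWP.IsPartitionFunction r c w (τ.arr .part) := by
  -- The refinements need `154`; set-up, loop exit and answer take at most `3 * w.length + 16`
  -- steps, hence at most `19 * max w.length 1`, so `200` is generous.
  refine ⟨200, fun r d hr hd w => ?_⟩
  obtain ⟨m, hm, τ, hreach, hτ⟩ :=
    FreeSolvableWP.exists_reachesIn_mainLoop (w := w) (le_refl d)
  obtain ⟨m', hm', σ, hreach', hσ⟩ := FreeSolvableWP.answer_spec hτ
  have hexit : FreeSolvableWP.ReachesIn 1 (FreeSolvableWP.mainLoop :: FreeSolvableWP.answer, τ)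
      (FreeSolvableWP.answer ++ [], τ) := .of_step (by
    simp [FreeSolvableWP.mainLoop, FreeSolvableWP.step, FreeSolvableWP.Test.holds, hτ.counter,
      hτ.const.cls])
  have hT := (hreach.trans hexit).trans (hreach' [])
  refine ⟨m + 1 + m', σ, hT, ?_, hσ.1, hσ.2, fun c _ hc => ?_⟩
  · have h1 := Nat.mul_le_mul_left d (FreeSolvableWP.refineTime_le (r := r) (by omega) w.length)
    have h2 : max w.length 1 ≤ d * r * max w.length 1 ^ 3 := by
      calc max w.length 1 = 1 * 1 * max w.length 1 ^ 1 := by ring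
        _ ≤ d * r * max w.length 1 ^ 3 := by
          gcongr
          · omega
          · omega
          · exact le_max_right _ _
          · norm_num
    have h3 : d * (154 * (r * max w.length 1 ^ 3)) = 154 * (d * r * max w.length 1 ^ 3) := by ring
    have h4 : 200 * d * r * max w.length 1 ^ 3 = 200 * (d * r * max w.length 1 ^ 3) := by ring
    omega
  · obtain ⟨l, -, ρ, hl, hρ⟩ := FreeSolvableWP.exists_reachesIn_mainLoop (w := w) hc
    -- Determinism places this intermediate visit before the halting time.
    exact ⟨l, hl.le_of_halts hT, ρ, hl, hρ.counter, hρ.part⟩
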